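/- Consider the deterministic synchronous message-passing model: an $n$-vertex undirected graph $G=(V,E)$ is given, each vertex hosts a processor with a unique identity number from $\{1,\dots,n\}$, and in each round each vertex may send a message (of unbounded size) to each of its neighbors; local computation is free. Initially a vertex knows only its own identity number and the global parameters $n$, $a$, $t$. The running time is the number of rounds until all vertices have terminated. The arboricity of $G$ is the minimum number of edge-disjoint forests into which $E$ can be partitioned. Theorem. For every constant $\mu>0$ there are a constant $C=C(\mu)$ and a deterministic distributed algorithm such that, for every integer $a$, every real parameter $t$ with $1\le t\le a$, and every $n$-vertex graph $G$ of arboricity at most $a$ (with any assignment of identity numbers), the algorithm computes a legal coloring $\varphi:V\to\{1,2,\dots,\lfloor C\cdot a\cdot t\rfloor\}$ of $G$ (that is, $\varphi(u)\ne\varphi(v)$ for every edge $(u,v)\in E$), within at most $C\cdot\left(\frac{a}{t}\right)^{\mu}\cdot\log_2 n$ rounds. In other words, an $O(a\cdot t)$-coloring of a graph of arboricity $a$ can be computed in $O\left(\left(\frac{a}{t}\right)^{\mu}\log n\right)$ time. -/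

import Mathlib

/-- `G.IsForestsDecomposition F`: the edge set of `G` is partitioned into the edge sets of the
`k` pairwise edge-disjoint forests `F 0, …, F (k - 1)`. -/
def SimpleGraph.IsForestsDecomposition {V : Type*} (G : SimpleGraph V) {k : ℕ}
    (F : Fin k → SimpleGraph V) : Prop :=
  (∀ i, (F i).IsAcyclic) ∧ Pairwise (fun i j => Disjoint (F i) (F j)) ∧ ⨆ i, F i = G

/-- The arboricity of `G`: the least number of edge-disjoint forests into which the edge set of `G`
can be partitioned (`⊤` if there is no such number, which does not happen for finite graphs). -/
noncomputable def SimpleGraph.arboricity {V : Type*} (G : SimpleGraph V) : ℕ∞ :=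
  sInf {x : ℕ∞ | ∃ (k : ℕ) (F : Fin k → SimpleGraph V), G.IsForestsDecomposition F ∧ x = k}

namespace Distributed

/-- A network: an undirected graph on `n` vertices, each of which hosts a processor with a unique
identity number from `{1, …, n}`. A processor distinguishes the edges at its vertex by port labels,
about which nothing is assumed but that distinct edges at a vertex have distinct labels. -/
structure Network (V : Type*) [Fintype V] where
  graph : SimpleGraph V
  id : V → ℕ
  id_injective : Function.Injective id
  id_mem : ∀ v, id v ∈ Set.Icc 1 (Fintype.card V)
  port : V → V → ℕ
  port_injOn : ∀ v, Set.InjOn (port v) (graph.neighborSet v)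

/-- A deterministic synchronous message-passing algorithm whose global parameters are of type `P`
and in which every vertex computes an output of type `O`. Messages are of unbounded size and local
computation is free.
* `init p i` is the initial state of a processor with identity number `i`.
* `send s q` is the message that a processor in state `s` sends through its port `q`.
* `receive s m` is the state after a round that began in state `s` and in which the message `m q`
  arrived through the port `q` (`none` if nothing arrived there).
* `output s = some o` means that a processor in state `s` has terminated with output `o`. -/
structure Algorithm (P O : Type) where
  State : Type
  Msg : Type
  init : P → ℕ → State
  send : State → ℕ → Msg
  receive : State → (ℕ → Option Msg) → State
  output : State → Option O

namespace Algorithm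

variable {P O : Type} {V : Type*} [Fintype V]

open Classical in
/-- The message that `v` receives through its port `q` in a round at whose beginning the states of
the processors are `σ`. Processors that have terminated send no messages. -/
noncomputable def inbox (A : Algorithm P O) (N : Network V) (σ : V → A.State) (v : V) (q : ℕ) :
    Option A.Msg :=
  if h : ∃ u, N.graph.Adj v u ∧ N.port v u = q then
    if (A.output (σ h.choose)).isSome then none
    else some (A.send (σ h.choose) (N.port h.choose v))
  else none

/-- Through the port that leads to its neighbour `u`, the vertex `v` receives what `u` sends
through the port that leads to `v`. -/
theorem inbox_port (A : Algorithm P O) (N : Network V) (σ : V → A.State) {v u : V}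
    (h : N.graph.Adj v u) :
    A.inbox N σ v (N.port v u) =
      if (A.output (σ u)).isSome then none else some (A.send (σ u) (N.port u v)) := by
  have hex : ∃ w, N.graph.Adj v w ∧ N.port v w = N.port v u := ⟨u, h, rfl⟩
  have hw : hex.choose = u := N.port_injOn v hex.choose_spec.1 h hex.choose_spec.2
  unfold inbox
  rw [dif_pos hex, hw]

/-- The states of the processors after `r` rounds of `A` on the network `N` with global
parameters `p`. The state of a processor that has terminated does not change any more. -/
noncomputable def run (A : Algorithm P O) (p : P) (N : Network V) : ℕ → V → A.State
  | 0 => fun v => A.init p (N.id v)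
  | r + 1 => fun v =>
      if (A.output (A.run p N r v)).isSome then A.run p N r v
      else A.receive (A.run p N r v) (A.inbox N (A.run p N r) v)

/-- Within `r` rounds of `A` on `N` with parameters `p`, every vertex `v` has terminated, with
output `φ v`. -/
def ComputesWithin (A : Algorithm P O) (p : P) (N : Network V) (r : ℕ) (φ : V → O) : Prop :=
  ∀ v, A.output (A.run p N r v) = some (φ v)

end Algorithm

/-- The global parameters of the colouring algorithm, known to all the processors: the number `n`
of vertices, the bound `a` on the arboricity, and the tradeoff parameter `t`. -/
structure ColoringParams where
  n : ℕ
  a : ℕ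
  t : ℝ

end Distributed

/-! Arboricity enters only through `Sparse`: every vertex set spans at most `s` times as many edges
as it has vertices. The vertices are kept partitioned into classes, and for a constant number `r > 2
/ μ` of phases every class is split into `p = ⌈(a / t) ^ (1 / r)⌉` parts, each phase lowering the
sparsity of the classes from `s` to `8 * s / p` (`Ready.exec_phaseProg`). At the end there are `p ^
r = O(a / t)` classes of sparsity `O(t)`. Each is coloured legally with `O(t ^ 2)` colours
(`Ready.exec_legalProg`), which makes `O(a * t)` colours in all.

In a phase, logarithmically many levels are computed such that a vertex has at most `4 * s`
neighbours in its class at its level or above (`exec_levelStep`). A defective colouring with `O(p ^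
2)` colours then refines the levels to ranks, so that at most `4 * s / p` of these neighbours share
the rank of a vertex (`exec_colProg`). In order of decreasing rank, each vertex chooses the part
least used by its neighbours of higher rank, again at most `4 * s / p` of them (`exec_pickProg`).
Orienting edges towards the rank that is not smaller bounds the sparsity of the parts.

There are `O(p ^ 2 * log n)` ranks, hence as many rounds, and `p ^ 2 = O((a / t) ^ (2 / r))` with `2
/ r ≤ μ`. -/

/-! ### Sparsity and arboricity -/

/-- Every set `S` of vertices of `G` spans at most `s * |S|` edges. -/
def SimpleGraph.Sparse {V : Type*} (G : SimpleGraph V) (s : ℕ) : Prop :=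
  ∀ S : Finset V, {e : V × V | e.1 ∈ S ∧ e.2 ∈ S ∧ G.Adj e.1 e.2}.ncard ≤ 2 * s * S.card

namespace SimpleGraph

open Finset

variable {V : Type*} {G : SimpleGraph V}

theorem Sparse.mono_right {s s' : ℕ} (h : G.Sparse s) (hs : s ≤ s') : G.Sparse s' := fun S =>
  (h S).trans (by gcongr)

theorem ncard_pairs_eq_sum [Finite V] (S : Finset V) (R : V → V → Prop) :
    {e : V × V | e.1 ∈ S ∧ R e.1 e.2}.ncard = ∑ v ∈ S, {u | R v u}.ncard := by
  classical
  have := Fintype.ofFinite V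
  rw [Set.ncard_eq_toFinset_card', Finset.card_eq_sum_card_fiberwise (f := Prod.fst)
    (t := S) (by intro e; simp +contextual)]
  refine Finset.sum_congr rfl fun v hv => ?_
  rw [Set.ncard_eq_toFinset_card']
  refine Finset.card_bij (fun e _ => e.2) ?_ ?_ ?_
  · rintro ⟨a, b⟩ h
    simp only [Set.toFinset_ofPred, Finset.mem_filter, Finset.mem_univ, true_and] at h ⊢
    simpa [← h.2] using h.1.2
  · rintro ⟨a, b⟩ h ⟨c, d⟩ h'
    simp only [Set.toFinset_ofPred, Finset.mem_filter, Finset.mem_univ, true_and] at h h'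
    simp_all
  · intro b hb
    exact ⟨(v, b), by simpa [hv] using hb, rfl⟩

/-- A forest extends to a spanning tree of the complete graph, whose degree sum is known. Ordered
pairs count every edge twice. -/
theorem IsAcyclic.ncard_pairs_le [Finite V] (h : G.IsAcyclic) :
    {e : V × V | G.Adj e.1 e.2}.ncard ≤ 2 * Nat.card V := by
  classical
  have := Fintype.ofFinite V
  rcases isEmpty_or_nonempty V with hV | hV
  · simp [Set.eq_empty_of_isEmpty]
  obtain ⟨T, hGT, -, hT⟩ := connected_top.exists_isTree_le_of_le_of_isAcyclic le_top h
  have h1 := T.sum_degrees_eq_twice_card_edges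
  have h2 := hT.card_edgeFinset
  have h3 := ncard_pairs_eq_sum Finset.univ T.Adj
  have h4 : ∀ v, {u | T.Adj v u}.ncard = T.degree v := fun v => by
    rw [← card_neighborSet_eq_degree, Set.fintypeCard_eq_ncard]
    rfl
  simp only [h4, Finset.mem_univ, true_and] at h3
  calc _ ≤ {e : V × V | T.Adj e.1 e.2}.ncard := Set.ncard_le_ncard fun e he => hGT he
    _ ≤ 2 * Nat.card V := by
      rw [Nat.card_eq_fintype_card]
      omega

theorem IsAcyclic.sparse_one [Finite V] (h : G.IsAcyclic) : G.Sparse 1 := by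
  intro S
  have h1 := (h.induce (S : Set V)).ncard_pairs_le
  have h2 : {e : V × V | e.1 ∈ S ∧ e.2 ∈ S ∧ G.Adj e.1 e.2} =
      Prod.map Subtype.val Subtype.val ''
        {e : ↥(S : Set V) × ↥(S : Set V) | (G.induce (S : Set V)).Adj e.1 e.2} := by
    ext ⟨a, b⟩
    simp
    tauto
  rw [h2, Set.ncard_image_of_injective _
    (Subtype.val_injective.prodMap Subtype.val_injective)]
  simpa using h1

theorem IsForestsDecomposition.sparse [Finite V] {k : ℕ} {F : Fin k → SimpleGraph V}
    (h : G.IsForestsDecomposition F) : G.Sparse k := by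
  intro S
  have hU : {e : V × V | e.1 ∈ S ∧ e.2 ∈ S ∧ G.Adj e.1 e.2} =
      ⋃ i ∈ (Finset.univ : Finset (Fin k)),
        {e : V × V | e.1 ∈ S ∧ e.2 ∈ S ∧ (F i).Adj e.1 e.2} := by
    ext e
    rw [← h.2.2]
    simp
  rw [hU]
  calc _ ≤ ∑ i : Fin k, {e : V × V | e.1 ∈ S ∧ e.2 ∈ S ∧ (F i).Adj e.1 e.2}.ncard :=
        Finset.set_ncard_biUnion_le _ _
    _ ≤ ∑ i : Fin k, 2 * 1 * S.card := Finset.sum_le_sum fun i _ => (h.1 i).sparse_one S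
    _ = 2 * k * S.card := by simp; ring

theorem sparse_of_arboricity_le [Finite V] {a : ℕ} (h : G.arboricity ≤ a) : G.Sparse a := by
  have hne : {x : ℕ∞ | ∃ (k : ℕ) (F : Fin k → SimpleGraph V),
      G.IsForestsDecomposition F ∧ x = k}.Nonempty := by
    by_contra hc
    rw [Set.not_nonempty_iff_eq_empty] at hc
    rw [arboricity, hc, sInf_empty] at h
    exact (ENat.natCast_ne_top a) (top_le_iff.1 h)
  obtain ⟨k, F, hF, hk⟩ := csInf_mem hne
  rw [arboricity, hk] at h
  exact hF.sparse.mono_right (by exact_mod_cast h)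

/-- A graph that can be oriented (edges may be oriented both ways) with out-degrees at most `s`
is sparse. -/
theorem sparse_of_orientation [Finite V] {s : ℕ} (R : V → V → Prop)
    (hR : ∀ u v, G.Adj u v → R u v ∨ R v u) (hs : ∀ v, {u | G.Adj v u ∧ R v u}.ncard ≤ s) :
    G.Sparse s := by
  intro S
  have key : {e : V × V | e.1 ∈ S ∧ G.Adj e.1 e.2 ∧ R e.1 e.2}.ncard ≤ s * S.card := by
    rw [ncard_pairs_eq_sum S fun v u => G.Adj v u ∧ R v u, mul_comm, ← smul_eq_mul]
    exact Finset.sum_le_card_nsmul _ _ _ fun v _ => hs v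
  have hsub : {e : V × V | e.1 ∈ S ∧ e.2 ∈ S ∧ G.Adj e.1 e.2} ⊆
      {e : V × V | e.1 ∈ S ∧ G.Adj e.1 e.2 ∧ R e.1 e.2} ∪
        Prod.swap '' {e : V × V | e.1 ∈ S ∧ G.Adj e.1 e.2 ∧ R e.1 e.2} := by
    rintro ⟨a, b⟩ ⟨ha, hb, hab⟩
    rcases hR a b hab with h | h
    · exact Or.inl ⟨ha, hab, h⟩
    · exact Or.inr ⟨(b, a), ⟨hb, hab.symm, h⟩, rfl⟩
  calc _ ≤ _ := Set.ncard_le_ncard hsub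
    _ ≤ _ := Set.ncard_union_le _ _
    _ ≤ s * S.card + s * S.card := by
        rw [Set.ncard_image_of_injective _ Prod.swap_injective]
        omega
    _ = 2 * s * S.card := by ring

/-- In a sparse graph, at most half of the vertices of a set `S` have more than `4 * s`
neighbours in `S`. -/
theorem Sparse.two_mul_card_le [Finite V] {s : ℕ} (h : G.Sparse s) {S T : Finset V} (hTS : T ⊆ S)
    (hT : ∀ v ∈ T, 4 * s < {u | G.Adj v u ∧ u ∈ S}.ncard) : 2 * #T ≤ #S := by
  -- Both sides bound the degree sum of the graph induced on `S`.
  have h1 : #T * (4 * s + 1) ≤ 2 * s * #S := by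
    calc #T * (4 * s + 1) ≤ ∑ v ∈ T, {u | G.Adj v u ∧ u ∈ S}.ncard := by
          rw [← smul_eq_mul]
          exact Finset.card_nsmul_le_sum _ _ _ hT
      _ ≤ ∑ v ∈ S, {u | G.Adj v u ∧ u ∈ S}.ncard := Finset.sum_le_sum_of_subset hTS
      _ = {e : V × V | e.1 ∈ S ∧ G.Adj e.1 e.2 ∧ e.2 ∈ S}.ncard :=
          (ncard_pairs_eq_sum S fun v u => G.Adj v u ∧ u ∈ S).symm
      _ ≤ 2 * s * #S := by
          refine le_trans (le_of_eq ?_) (h S)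
          congr 1
          ext e
          simp only [Set.mem_ofPred_eq]
          tauto
  rcases Nat.eq_zero_or_pos s with rfl | hs
  · have : #T = 0 := by simpa using h1
    omega
  · refine Nat.le_of_mul_le_mul_left (c := 2 * s) ?_ (by omega)
    nlinarith

end SimpleGraph

/-! ### Programs that count neighbours, and their execution in the model -/

namespace Distributed

/-- The rule by which a processor changes its state in a round in which all its neighbours tell it
their states: it depends on its own state and on the numbers of neighbours whose states have given
properties. -/
abbrev Step (S : Type) := S → ((S → Prop) → ℕ) → S

section Exec

variable {S : Type} {V : Type*}

/-- One round of a rule on the configuration `σ`. -/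
noncomputable def Step.apply (G : SimpleGraph V) (f : Step S) (σ : V → S) : V → S := fun v =>
  f (σ v) fun P => {u | G.Adj v u ∧ P (σ u)}.ncard

/-- The configuration after the rounds of a program, which is a list of rules. -/
noncomputable def exec (G : SimpleGraph V) (l : List (Step S)) (σ : V → S) : V → S :=
  l.foldl (fun τ f => f.apply G τ) σ

@[simp] theorem exec_nil (G : SimpleGraph V) (σ : V → S) : exec G [] σ = σ := rfl

@[simp] theorem exec_cons (G : SimpleGraph V) (f : Step S) (l : List (Step S)) (σ : V → S) :
    exec G (f :: l) σ = exec G l (f.apply G σ) := rfl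

@[simp] theorem exec_append (G : SimpleGraph V) (l l' : List (Step S)) (σ : V → S) :
    exec G (l ++ l') σ = exec G l' (exec G l σ) := List.foldl_append

end Exec

/-- If no processor has terminated, and every processor sends the same message to all its
neighbours, then a processor can count the neighbours whose messages have a given property. -/
theorem Algorithm.ncard_inbox {P O : Type} {V : Type*} [Fintype V] (A : Algorithm P O)
    (N : Network V) (σ : V → A.State) (msg : V → A.Msg) (hout : ∀ u, A.output (σ u) = none)
    (hmsg : ∀ u q, A.send (σ u) q = msg u) (v : V) (Q : A.Msg → Prop) :
    {q | ∃ x, A.inbox N σ v q = some x ∧ Q x}.ncard =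
      {u | N.graph.Adj v u ∧ Q (msg u)}.ncard := by
  have hinbox : ∀ u, N.graph.Adj v u → A.inbox N σ v (N.port v u) = some (msg u) := by
    intro u hu
    rw [Algorithm.inbox_port _ _ _ hu, hout, hmsg]
    simp
  have himage : {q | ∃ x, A.inbox N σ v q = some x ∧ Q x} =
      N.port v '' {u | N.graph.Adj v u ∧ Q (msg u)} := by
    ext q
    constructor
    · rintro ⟨x, hx, hQ⟩
      by_cases h : ∃ u, N.graph.Adj v u ∧ N.port v u = q
      · obtain ⟨u, hu, rfl⟩ := h
        rw [hinbox u hu, Option.some_inj] at hx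
        exact ⟨u, ⟨hu, hx ▸ hQ⟩, rfl⟩
      · rw [Algorithm.inbox, dif_neg h] at hx
        cases hx
    · rintro ⟨u, ⟨hu, hQ⟩, rfl⟩
      exact ⟨msg u, hinbox u hu, hQ⟩
  rw [himage]
  exact Set.InjOn.ncard_image fun a ha b hb h => N.port_injOn v ha.1 hb.1 h

/-- The algorithm whose processors execute the program that the global parameters determine, and
terminate at its end. -/
noncomputable def programAlgorithm {P O S : Type} (prog : P → List (Step S)) (init : P → ℕ → S)
    (out : S → O) : Algorithm P O where
  State := List (Step S) × S
  Msg := S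
  init p i := (prog p, init p i)
  send s _ := s.2
  receive s m := match s.1 with
    | [] => s
    | f :: l => (l, f s.2 fun P => {q | ∃ x, m q = some x ∧ P x}.ncard)
  output s := match s.1 with
    | [] => some (out s.2)
    | _ :: _ => none

variable {P O S : Type} {prog : P → List (Step S)} {init : P → ℕ → S} {out : S → O}
  {V : Type*} [Fintype V]

/-- All processors are at the same place of the same program, so none terminates early, every
message arrives, and counting ports amounts to counting neighbours. -/
theorem programAlgorithm_run (N : Network V) (p : P) (r : ℕ) (hr : r ≤ (prog p).length) :
    (programAlgorithm prog init out).run p N r = fun v => ((prog p).drop r,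
      exec N.graph ((prog p).take r) (fun u => init p (N.id u)) v) := by
  induction r with
  | zero => rfl
  | succ r ih =>
    have hlt : r < (prog p).length := hr
    funext v
    rw [Algorithm.run, ih hlt.le, List.take_succ_eq_append_getElem hlt, exec_append,
      List.drop_eq_getElem_cons hlt]
    set σ := exec N.graph ((prog p).take r) fun u => init p (N.id u)
    have hinbox := (programAlgorithm prog init out).ncard_inbox N
      (fun u => ((prog p)[r] :: (prog p).drop (r + 1), σ u)) σ
      (fun _ => rfl) (fun _ _ => rfl) v
    exact (if_neg Bool.false_ne_true).trans
      (Prod.ext rfl (congrArg ((prog p)[r] (σ v)) (funext hinbox)))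

theorem programAlgorithm_computesWithin (N : Network V) (p : P) :
    (programAlgorithm prog init out).ComputesWithin p N (prog p).length
      fun v => out (exec N.graph (prog p) (fun u => init p (N.id u)) v) := by
  intro v
  rw [programAlgorithm_run N p _ le_rfl, List.drop_length, List.take_length]
  rfl

end Distributed

/-! ### Quadratic polynomials modulo a prime, averaging, choice of primes -/

section

open Finset

/-- The value at `x`, modulo `q`, of the quadratic polynomial whose coefficients are the last three
digits of `c` in base `q`. -/
def digitQuadratic (q c x : ℕ) : ℕ := (c % q + c / q % q * x + c / q / q % q * x ^ 2) % q

theorem digitQuadratic_lt {q : ℕ} (hq : 0 < q) (c x : ℕ) : digitQuadratic q c x < q :=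
  Nat.mod_lt _ hq

-- Distinct numbers below `q ^ 3` differ in one of three digits, so the difference of their
-- quadratics is a nonzero polynomial of degree at most 2 over a field.
open Polynomial in
theorem card_digitQuadratic_eq_le {q : ℕ} (hq : q.Prime) {c d : ℕ} (hc : c < q ^ 3) (hd : d < q ^ 3)
    (hcd : c ≠ d) : #{x ∈ range q | digitQuadratic q c x = digitQuadratic q d x} ≤ 2 := by
  have := Fact.mk hq
  set f : (ZMod q)[X] := C (((c / q / q % q : ℕ) : ZMod q) - ((d / q / q % q : ℕ) : ZMod q)) * X ^ 2
    + C (((c / q % q : ℕ) : ZMod q) - ((d / q % q : ℕ) : ZMod q)) * X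
    + C (((c % q : ℕ) : ZMod q) - ((d % q : ℕ) : ZMod q)) with hf
  have hcast : ∀ a b : ℕ, ((a % q : ℕ) : ZMod q) - ((b % q : ℕ) : ZMod q) = 0 → a % q = b % q := by
    intro a b h
    rw [sub_eq_zero, ZMod.natCast_eq_natCast_iff] at h
    simpa [Nat.ModEq] using h
  have hdiv : ∀ a, a < q ^ 3 → a / q / q % q = a / q / q := fun a ha =>
    Nat.mod_eq_of_lt (by
      rw [Nat.div_div_eq_div_mul]
      exact Nat.div_lt_of_lt_mul (by linarith [pow_succ q 2, sq q]))
  have hf0 : f ≠ 0 := by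
    intro h0
    have e2 := congrArg (fun g => g.coeff 2) h0
    have e1 := congrArg (fun g => g.coeff 1) h0
    have e0 := congrArg (fun g => g.coeff 0) h0
    simp only [hf, coeff_add, coeff_C_mul, coeff_X_pow, coeff_X, coeff_C, coeff_zero] at e0 e1 e2
    norm_num at e0 e1 e2
    apply hcd
    have h2 : c / q / q = d / q / q := by
      rw [← hdiv c hc, ← hdiv d hd]
      exact hcast _ _ (by simpa using e2)
    have h1 : c / q = d / q := by
      rw [← Nat.div_add_mod (c / q) q, ← Nat.div_add_mod (d / q) q, h2,
        hcast _ _ (by simpa using e1)]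
    rw [← Nat.div_add_mod c q, ← Nat.div_add_mod d q, h1, hcast _ _ (by simpa using e0)]
  have hdeg : f.natDegree ≤ 2 := natDegree_quadratic_le
  refine le_trans ?_ ((card_roots' f).trans hdeg)
  refine le_trans ?_ (Multiset.toFinset_card_le f.roots)
  refine Finset.card_le_card_of_injOn (fun x : ℕ => (x : ZMod q)) ?_ ?_
  · intro x hx
    have hx' := (Finset.mem_filter.1 (Finset.mem_coe.1 hx)).2
    have := (ZMod.natCast_eq_natCast_iff _ _ _).2 hx'
    push_cast at this
    refine Finset.mem_coe.2 (Multiset.mem_toFinset.2 ((mem_roots hf0).2 ?_))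
    simp only [IsRoot, hf, eval_add, eval_mul, eval_C, eval_pow, eval_X]
    linear_combination this
  · intro x hx y hy hxy
    have hx' := Finset.mem_range.1 (Finset.mem_filter.1 (Finset.mem_coe.1 hx)).1
    have hy' := Finset.mem_range.1 (Finset.mem_filter.1 (Finset.mem_coe.1 hy)).1
    have := (ZMod.natCast_eq_natCast_iff _ _ _).1 hxy
    rwa [Nat.ModEq, Nat.mod_eq_of_lt hx', Nat.mod_eq_of_lt hy'] at this

/-- If every element of `S` belongs to at most `k` of the sets `{u | R x u}` with `x < q`, then one
of these sets contains at most `k * |S| / q` elements of `S`. -/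
theorem exists_lt_ncard_mul_le {V : Type*} [Finite V] (S : Set V) {q k : ℕ} (hq : 0 < q)
    (R : ℕ → V → Prop) [∀ x u, Decidable (R x u)] (hR : ∀ u ∈ S, #{x ∈ range q | R x u} ≤ k) :
    ∃ x < q, {u | u ∈ S ∧ R x u}.ncard * q ≤ k * S.ncard := by
  classical
  have := Fintype.ofFinite V
  by_contra! hcon
  have h1 : ∑ x ∈ range q, {u | u ∈ S ∧ R x u}.ncard ≤ k * S.ncard := by
    have h2 := sum_card_bipartiteAbove_eq_sum_card_bipartiteBelow R (s := range q) (t := S.toFinset)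
    calc ∑ x ∈ range q, {u | u ∈ S ∧ R x u}.ncard
        = ∑ x ∈ range q, #(bipartiteAbove R S.toFinset x) := by
          refine Finset.sum_congr rfl fun x _ => ?_
          rw [Set.ncard_eq_toFinset_card']
          congr 1
          ext u
          simp [bipartiteAbove]
      _ = _ := h2
      _ ≤ #S.toFinset • k := Finset.sum_le_card_nsmul _ _ _ fun u hu => hR u (by simpa using hu)
      _ = k * S.ncard := by rw [Set.ncard_eq_toFinset_card', smul_eq_mul, mul_comm]
  have h3 : ∑ x ∈ range q, k * S.ncard < ∑ x ∈ range q, {u | u ∈ S ∧ R x u}.ncard * q :=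
    Finset.sum_lt_sum_of_nonempty ⟨0, by simpa using hq⟩ fun x hx => hcon x (by simpa using hx)
  rw [Finset.sum_const, card_range, smul_eq_mul, ← Finset.sum_mul, mul_comm q] at h3
  exact absurd h1 (not_le.2 (lt_of_mul_lt_mul_right h3 (Nat.zero_le q)))

theorem exists_prime_between (m : ℕ) : ∃ q, q.Prime ∧ m < q ∧ q ≤ 2 * m + 2 := by
  rcases Nat.eq_zero_or_pos m with rfl | hm
  · exact ⟨2, Nat.prime_two, by norm_num, by norm_num⟩
  · obtain ⟨q, h1, h2, h3⟩ := Nat.exists_prime_lt_and_le_two_mul m hm.ne'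
    exact ⟨q, h1, h2, by omega⟩

/-- A prime number between `m` and `2 * m + 2`. -/
noncomputable def primeAfter (m : ℕ) : ℕ := (exists_prime_between m).choose

theorem prime_primeAfter (m : ℕ) : (primeAfter m).Prime := (exists_prime_between m).choose_spec.1

theorem lt_primeAfter (m : ℕ) : m < primeAfter m := (exists_prime_between m).choose_spec.2.1

theorem primeAfter_le (m : ℕ) : primeAfter m ≤ 2 * m + 2 := (exists_prime_between m).choose_spec.2.2

end

/-! ### Levels, defective colours and choice of parts -/

namespace Distributed

open Finset

/-- The state of a processor of the colouring algorithm: its identity number, its class in the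
current partition of the vertices, its level in the current H-partition, its current defective
colour, and the part of its class into which it chooses to go. -/
@[ext] structure ProcState where
  ident : ℕ
  cls : ℕ
  level : ℕ
  col : ℕ
  pick : ℕ

/-- A processor moves to the next level if more than `D` neighbours in its class are at its level
or above. -/
noncomputable def levelStep (D : ℕ) : Step ProcState := fun s count =>
  if D < count (fun x => x.cls = s.cls ∧ s.level ≤ x.level) then
    { s with level := s.level + 1 } else s

/-- A reduction of the number of colours to `q ^ 2`, at the price of a few more conflicts with
neighbours in the same class that are not at a lower level. -/
noncomputable def colStep (D q : ℕ) : Step ProcState := fun s count =>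
  let x := sInf {x | x < q ∧ count (fun y => (y.cls = s.cls ∧ s.level ≤ y.level) ∧
    y.col ≠ s.col ∧ digitQuadratic q y.col x = digitQuadratic q s.col x) * q ≤ 2 * D}
  { s with col := x + q * digitQuadratic q s.col x }

/-- The position of a processor in the order in which the processors choose their parts. -/
def ProcState.rank (Q : ℕ) (s : ProcState) : ℕ := s.level * Q + s.col

/-- The processors of rank `k` choose a part that few neighbours of higher rank have chosen. -/
noncomputable def pickStep (D p Q k : ℕ) : Step ProcState := fun s count =>
  if s.rank Q = k then
    { s with pick := sInf {c | c < p ∧ count (fun y => (y.cls = s.cls ∧ k < y.rank Q) ∧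
      y.pick = c) * p ≤ D} }
  else s

/-- The classes are split into `p` parts each, according to the choices of the processors. -/
def refineStep (p : ℕ) : Step ProcState := fun s _ =>
  { ident := s.ident, cls := s.cls * p + s.pick, level := 0, col := s.ident, pick := 0 }

variable {V : Type*} {G : SimpleGraph V}

/-- The subgraph of the edges that join vertices in the same class. -/
def classGraph (G : SimpleGraph V) (c : V → ℕ) : SimpleGraph V where
  Adj u v := G.Adj u v ∧ c v = c u
  symm := ⟨fun _ _ h => ⟨h.1.symm, h.2.symm⟩⟩
  loopless := ⟨fun _ h => G.loopless.irrefl _ h.1⟩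

@[simp] theorem classGraph_adj {c : V → ℕ} {u v : V} :
    (classGraph G c).Adj u v ↔ G.Adj u v ∧ c v = c u := Iff.rfl

variable [Finite V]

/-- Only vertices at the top level can move: those below have failed the test once, and the count
that they test never changes afterwards. By sparsity at most half of the top level moves on. -/
theorem exec_levelStep {s : ℕ} {σ : V → ProcState}
    (hs : (classGraph G fun v => (σ v).cls).Sparse s) (h0 : ∀ v, (σ v).level = 0) (k : ℕ) :
    ∃ lev : V → ℕ, exec G (List.replicate k (levelStep (4 * s))) σ =
        (fun v => { σ v with level := lev v }) ∧ (∀ v, lev v ≤ k) ∧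
      (∀ v, lev v < k →
        {u | (classGraph G fun v => (σ v).cls).Adj v u ∧ lev v ≤ lev u}.ncard ≤ 4 * s) ∧
      {v | lev v = k}.ncard * 2 ^ k ≤ Nat.card V := by
  classical
  have := Fintype.ofFinite V
  set H := classGraph G fun v => (σ v).cls with hH
  induction k with
  | zero =>
    refine ⟨fun _ => 0, ?_, by simp, by simp, by simp [Set.ncard_univ]⟩
    funext v
    simp [ProcState.ext_iff, h0]
  | succ k ih =>
    obtain ⟨lev, h1, h2, h3, h4⟩ := ih
    set move : V → Prop := fun v => 4 * s < {u | H.Adj v u ∧ lev v ≤ lev u}.ncard with hmove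
    have hmk : ∀ v, move v → lev v = k := fun v hv => by
      by_contra hne
      exact absurd (h3 v (lt_of_le_of_ne (h2 v) hne)) (not_le.2 hv)
    -- A vertex that moves is already at level `k`, so its move affects no comparison with a
    -- threshold up to `k`.
    have hup : ∀ u i, i ≤ k → (i ≤ (if move u then lev u + 1 else lev u) ↔ i ≤ lev u) := by
      intro u i hi
      split_ifs with hu
      · have := hmk u hu
        omega
      · rfl
    refine ⟨fun v => if move v then lev v + 1 else lev v, ?_, ?_, ?_, ?_⟩
    · rw [List.replicate_succ', exec_append, h1, exec_cons, exec_nil]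
      funext v
      simp only [Step.apply, levelStep, hmove, hH, classGraph_adj, and_assoc]
      split_ifs <;> rfl
    · intro v
      have := h2 v
      dsimp only
      split_ifs <;> omega
    · intro v hv
      have hv' : ¬ move v := fun hm => by
        have := hmk v hm
        simp only [hm, if_true] at hv
        omega
      simp only [hv', if_false] at hv ⊢
      simp only [hup _ (lev v) (h2 v)]
      exact not_lt.1 hv'
    · have hST : 2 * #{v | move v} ≤ #{v | lev v = k} := by
        refine hs.two_mul_card_le (fun v hv => by simpa using hmk v (by simpa using hv)) ?_
        intro v hv
        have hv' : move v := by simpa using hv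
        have hk := hmk v hv'
        refine lt_of_lt_of_le hv' (Set.ncard_le_ncard ?_)
        rintro u ⟨hu, hle⟩
        have := h2 u
        exact ⟨hu, by simp; omega⟩
      have heq : {v | (if move v then lev v + 1 else lev v) = k + 1} = {v | move v} := by
        ext v
        have := h2 v
        have := hmk v
        simp only [Set.mem_ofPred_eq]
        split_ifs with hm <;> simp [hm] <;> omega
      rw [heq, Set.ncard_eq_toFinset_card']
      rw [Set.ncard_eq_toFinset_card'] at h4
      simp only [Set.toFinset_ofPred] at h4 ⊢
      calc _ = 2 * #{v | move v} * 2 ^ k := by ring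
        _ ≤ _ := Nat.mul_le_mul_right _ hST
        _ ≤ _ := h4

/-- The new colour encodes a point `x` and the value there of the quadratic of the old colour. A new
conflict requires the same `x` and agreement of two different quadratics at it. Each neighbour
agrees at no more than 2 of the `q` points, so some point has at most `2 * D / q` such neighbours.
-/
theorem colStep_apply {D q : ℕ} (hq : q.Prime) {σ : V → ProcState}
    (hD : ∀ v, {u | (classGraph G fun v => (σ v).cls).Adj v u ∧
      (σ v).level ≤ (σ u).level}.ncard ≤ D) (hcol : ∀ v, (σ v).col < q ^ 3) :
    ∃ col : V → ℕ, (colStep D q).apply G σ = (fun v => { σ v with col := col v }) ∧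
      (∀ v, col v < q ^ 2) ∧
      ∀ v, {u | (classGraph G fun v => (σ v).cls).Adj v u ∧ (σ v).level ≤ (σ u).level ∧
          col u = col v}.ncard * q ≤
        {u | (classGraph G fun v => (σ v).cls).Adj v u ∧ (σ v).level ≤ (σ u).level ∧
          (σ u).col = (σ v).col}.ncard * q + 2 * D := by
  classical
  set H := classGraph G fun v => (σ v).cls with hH
  set good : V → Set ℕ := fun v => {x | x < q ∧ {u | G.Adj v u ∧ ((σ u).cls = (σ v).cls ∧
    (σ v).level ≤ (σ u).level) ∧ (σ u).col ≠ (σ v).col ∧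
    digitQuadratic q (σ u).col x = digitQuadratic q (σ v).col x}.ncard * q ≤ 2 * D} with hgood
  set x : V → ℕ := fun v => sInf (good v) with hx
  have hmem : ∀ v, x v ∈ good v := by
    intro v
    refine Nat.sInf_mem ?_
    obtain ⟨y, hy, hy'⟩ := exists_lt_ncard_mul_le
      {u | H.Adj v u ∧ (σ v).level ≤ (σ u).level} (k := 2) hq.pos
      (fun x u => (σ u).col ≠ (σ v).col ∧
        digitQuadratic q (σ u).col x = digitQuadratic q (σ v).col x) (by
        intro u _
        by_cases h : (σ u).col = (σ v).col
        · simp [h]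
        · simpa [h] using card_digitQuadratic_eq_le hq (hcol u) (hcol v) h)
    refine ⟨y, hy, le_trans (le_of_eq ?_) (hy'.trans (Nat.mul_le_mul_left 2 (hD v)))⟩
    simp [hH, and_assoc]
  refine ⟨fun v => x v + q * digitQuadratic q (σ v).col (x v), rfl, ?_, ?_⟩
  · intro v
    have h1 := (hmem v).1
    have h2 := digitQuadratic_lt hq.pos (σ v).col (x v)
    nlinarith
  · intro v
    have hsub : {u | H.Adj v u ∧ (σ v).level ≤ (σ u).level ∧
        x u + q * digitQuadratic q (σ u).col (x u) = x v + q * digitQuadratic q (σ v).col (x v)} ⊆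
      {u | H.Adj v u ∧ (σ v).level ≤ (σ u).level ∧ (σ u).col = (σ v).col} ∪
      {u | G.Adj v u ∧ ((σ u).cls = (σ v).cls ∧ (σ v).level ≤ (σ u).level) ∧
        (σ u).col ≠ (σ v).col ∧
        digitQuadratic q (σ u).col (x v) = digitQuadratic q (σ v).col (x v)} := by
      rintro u ⟨hu, hl, hc⟩
      by_cases h : (σ u).col = (σ v).col
      · exact Or.inl ⟨hu, hl, h⟩
      · have h1 : x u = x v := by
          have := congrArg (· % q) hc
          simpa [Nat.mod_eq_of_lt (hmem u).1, Nat.mod_eq_of_lt (hmem v).1] using this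
        rw [h1] at hc
        have h2 := Nat.eq_of_mul_eq_mul_left hq.pos (Nat.add_left_cancel hc)
        exact Or.inr ⟨hu.1, ⟨hu.2, hl⟩, h, h2⟩
    calc _ ≤ (_ + _) * q :=
          Nat.mul_le_mul_right _ ((Set.ncard_le_ncard hsub).trans (Set.ncard_union_le _ _))
      _ ≤ _ := by
        rw [add_mul]
        exact Nat.add_le_add_left (hmem v).2 _

/-- A sequence of colour reductions, whose last one leads to `q ^ 2` colours. -/
noncomputable def colProg (D : ℕ) : ℕ → ℕ → List (Step ProcState)
  | 0, q => [colStep D q]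
  | j + 1, q => colProg D j (primeAfter (2 * q)) ++ [colStep D q]

theorem length_colProg (D j q : ℕ) : (colProg D j q).length = j + 1 := by
  induction j generalizing q with
  | zero => rfl
  | succ j ih => simp [colProg, ih]

/-- Injective colours start without conflicts. Going back from the last reduction, the moduli at
least double, so the added defects `2 * D / q` form a series bounded by `4 * D / q`. The condition
`18 ≤ q` makes the colours left by one reduction fit below the cube of the next modulus. -/
theorem exec_colProg {D j q : ℕ} (hq : q.Prime) (hq' : 18 ≤ q) {σ : V → ProcState}
    (hD : ∀ v, {u | (classGraph G fun v => (σ v).cls).Adj v u ∧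
      (σ v).level ≤ (σ u).level}.ncard ≤ D) (hcol : ∀ v, (σ v).col < 2 ^ j * q)
    (hinj : Function.Injective fun v => (σ v).col) :
    ∃ col : V → ℕ, exec G (colProg D j q) σ = (fun v => { σ v with col := col v }) ∧
      (∀ v, col v < q ^ 2) ∧
      ∀ v, {u | (classGraph G fun v => (σ v).cls).Adj v u ∧ (σ v).level ≤ (σ u).level ∧
          col u = col v}.ncard * q ≤ 4 * D := by
  induction j generalizing q with
  | zero =>
    obtain ⟨col, h1, h2, h3⟩ := colStep_apply hq hD fun v => (hcol v).trans_le (by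
      rw [pow_zero, one_mul]
      exact Nat.le_self_pow (by norm_num) q)
    refine ⟨col, h1, h2, fun v => ?_⟩
    have hempty : {u | (classGraph G fun v => (σ v).cls).Adj v u ∧ (σ v).level ≤ (σ u).level ∧
        (σ u).col = (σ v).col} = ∅ := by
      ext u
      simp only [Set.mem_ofPred_eq, Set.mem_empty_iff_false, iff_false]
      rintro ⟨hu, -, hc⟩
      exact hu.ne (hinj hc).symm
    have := h3 v
    rw [hempty, Set.ncard_empty] at this
    omega
  | succ j ih =>
    have hlt := lt_primeAfter (2 * q)
    have hle := primeAfter_le (2 * q)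
    obtain ⟨col, h1, h2, h3⟩ := ih (prime_primeAfter (2 * q)) (by omega) fun v =>
      (hcol v).trans_le (by
        rw [pow_succ, mul_assoc]
        exact Nat.mul_le_mul_left _ hlt.le)
    set τ : V → ProcState := fun v => { σ v with col := col v } with hτ
    obtain ⟨col', hc1, hc2, hc3⟩ := colStep_apply (G := G) (σ := τ) hq hD fun v =>
      (h2 v).trans_le (by
        calc _ ≤ (4 * q + 2) ^ 2 := Nat.pow_le_pow_left (by omega) 2
          _ ≤ 18 * q ^ 2 := by nlinarith
          _ ≤ q * q ^ 2 := Nat.mul_le_mul_right _ hq'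
          _ = q ^ 3 := by ring)
    refine ⟨col', ?_, hc2, fun v => (hc3 v).trans ?_⟩
    · rw [colProg, exec_append, h1, exec_cons, exec_nil, hc1]
    · have := h3 v
      have h4 := Nat.mul_le_mul_left {u | (classGraph G fun v => (σ v).cls).Adj v u ∧
        (σ v).level ≤ (σ u).level ∧ col u = col v}.ncard hlt.le
      -- The earlier reductions, ending with a modulus above `2 * q`, account for half of the
      -- allowed defect.
      have h5 : {u | (classGraph G fun v => (τ v).cls).Adj v u ∧
        (τ v).level ≤ (τ u).level ∧ (τ u).col = (τ v).col}.ncard * q ≤ 2 * D := by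
        change {u | (classGraph G fun v => (σ v).cls).Adj v u ∧
          (σ v).level ≤ (σ u).level ∧ col u = col v}.ncard * q ≤ 2 * D
        nlinarith
      omega

/-- The processors of rank less than `k` choose their parts, in the order of decreasing ranks. -/
noncomputable def pickProg (D p Q : ℕ) : ℕ → List (Step ProcState)
  | 0 => []
  | k + 1 => pickStep D p Q k :: pickProg D p Q k

theorem length_pickProg (D p Q k : ℕ) : (pickProg D p Q k).length = k := by
  induction k with
  | zero => rfl
  | succ k ih => simp [pickProg, ih]

/-- The invariant `hpick` says that ranks from `k` on have chosen well. Later choices, made at lower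
ranks, cannot spoil this. At each turn one of the `p` parts has been chosen by at most `D / p` of
the neighbours of higher rank. -/
theorem exec_pickProg {D p Q : ℕ} (hp : 0 < p) (k : ℕ) {σ : V → ProcState}
    (hD : ∀ v, {u | (classGraph G fun v => (σ v).cls).Adj v u ∧
      (σ v).rank Q < (σ u).rank Q}.ncard ≤ D)
    (hpick : ∀ v, k ≤ (σ v).rank Q → (σ v).pick < p ∧
      {u | (classGraph G fun v => (σ v).cls).Adj v u ∧ (σ v).rank Q < (σ u).rank Q ∧
        (σ u).pick = (σ v).pick}.ncard * p ≤ D) :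
    ∃ pick : V → ℕ, exec G (pickProg D p Q k) σ = (fun v => { σ v with pick := pick v }) ∧
      (∀ v, pick v < p) ∧
      ∀ v, {u | (classGraph G fun v => (σ v).cls).Adj v u ∧ (σ v).rank Q < (σ u).rank Q ∧
        pick u = pick v}.ncard * p ≤ D := by
  classical
  induction k generalizing σ with
  | zero => exact ⟨fun v => (σ v).pick, rfl, fun v => (hpick v (Nat.zero_le _)).1,
      fun v => (hpick v (Nat.zero_le _)).2⟩
  | succ k ih =>
    set H := classGraph G fun v => (σ v).cls with hH
    set good : V → Set ℕ := fun v => {c | c < p ∧ {u | G.Adj v u ∧ ((σ u).cls = (σ v).cls ∧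
      k < (σ u).rank Q) ∧ (σ u).pick = c}.ncard * p ≤ D} with hgood
    set x : V → ℕ := fun v => if (σ v).rank Q = k then sInf (good v) else (σ v).pick with hx
    have hmem : ∀ v, (σ v).rank Q = k → sInf (good v) ∈ good v := by
      intro v hv
      refine Nat.sInf_mem ?_
      obtain ⟨y, hy, hy'⟩ := exists_lt_ncard_mul_le
        {u | H.Adj v u ∧ (σ v).rank Q < (σ u).rank Q} (k := 1) hp
        (fun x u => (σ u).pick = x) (by
          intro u _
          refine Finset.card_le_one.2 fun a ha b hb => ?_
          rw [← (Finset.mem_filter.1 ha).2, ← (Finset.mem_filter.1 hb).2])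
      refine ⟨y, hy, le_trans (le_of_eq ?_) (hy'.trans ((one_mul _).trans_le (hD v)))⟩
      simp [hH, and_assoc, hv]
    have hstep : (pickStep D p Q k).apply G σ = fun v => { σ v with pick := x v } := by
      funext v
      simp only [Step.apply, pickStep, hx]
      split_ifs <;> rfl
    have hsame : ∀ v u, k ≤ (σ v).rank Q → (σ v).rank Q < (σ u).rank Q → x u = (σ u).pick :=
      fun v u hv hu => if_neg (by omega)
    obtain ⟨pick, h1, h2, h3⟩ := ih (σ := fun v => { σ v with pick := x v }) hD (by
      intro v hv
      replace hv : k ≤ (σ v).rank Q := hv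
      change x v < p ∧ {u | H.Adj v u ∧ (σ v).rank Q < (σ u).rank Q ∧ x u = x v}.ncard * p ≤ D
      have hset : {u | H.Adj v u ∧ (σ v).rank Q < (σ u).rank Q ∧ x u = x v} =
          {u | H.Adj v u ∧ (σ v).rank Q < (σ u).rank Q ∧ (σ u).pick = x v} := by
        ext u
        refine and_congr_right fun _ => and_congr_right fun hu => ?_
        rw [hsame v u hv hu]
      rw [hset]
      by_cases hk : (σ v).rank Q = k
      · have hxv : x v = sInf (good v) := if_pos hk
        obtain ⟨ha, hb⟩ := hmem v hk
        rw [hxv]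
        refine ⟨ha, le_trans (le_of_eq ?_) hb⟩
        simp [hH, and_assoc, hk]
      · have hxv : x v = (σ v).pick := if_neg hk
        rw [hxv]
        exact hpick v (by omega))
    refine ⟨pick, ?_, h2, h3⟩
    rw [pickProg, exec_cons, hstep, h1]

end Distributed

/-! ### Phases, legal colouring of the classes, and the whole program -/

namespace Distributed

variable {V : Type*} {G : SimpleGraph V} [Finite V]

/-- Levels and defective colours are computed. -/
noncomputable def partitionProg (L s q : ℕ) : List (Step ProcState) :=
  List.replicate L (levelStep (4 * s)) ++ colProg (4 * s) L q

/-- The configuration `σ` is one in which the next phase can begin: the vertices are partitioned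
into at most `K` classes that induce sparse graphs. -/
structure Ready (G : SimpleGraph V) (L s K : ℕ) (σ : V → ProcState) : Prop where
  sparse : (classGraph G fun v => (σ v).cls).Sparse s
  level : ∀ v, (σ v).level = 0
  col : ∀ v, (σ v).col = (σ v).ident
  ident_injective : Function.Injective fun v => (σ v).ident
  ident_lt : ∀ v, (σ v).ident < 2 ^ L
  cls_lt : ∀ v, (σ v).cls < K

/-- Level `L` is empty, since it has at most `Nat.card V / 2 ^ L < 1` vertices; thus the degree
bound holds everywhere. The colour reductions are then run with `D = 4 * s`. -/
theorem Ready.exec_partitionProg {L s K q : ℕ} {σ : V → ProcState} (h : Ready G L s K σ)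
    (hL : Nat.card V < 2 ^ L) (hq : q.Prime) (hq' : 18 ≤ q) :
    ∃ lev col : V → ℕ, exec G (partitionProg L s q) σ =
        (fun v => { σ v with level := lev v, col := col v }) ∧
      (∀ v, lev v < L) ∧ (∀ v, col v < q ^ 2) ∧
      (∀ v, {u | (classGraph G fun v => (σ v).cls).Adj v u ∧ lev v ≤ lev u}.ncard ≤ 4 * s) ∧
      ∀ v, {u | (classGraph G fun v => (σ v).cls).Adj v u ∧ lev v ≤ lev u ∧
        col u = col v}.ncard * q ≤ 16 * s := by
  obtain ⟨lev, h1, h2, h3, h4⟩ := exec_levelStep h.sparse h.level L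
  have hlt : ∀ v, lev v < L := by
    intro v
    refine lt_of_le_of_ne (h2 v) fun hv => ?_
    have hpos : 0 < {v | lev v = L}.ncard := (Set.ncard_pos).2 ⟨v, hv⟩
    nlinarith [Nat.le_mul_of_pos_left (2 ^ L) hpos]
  obtain ⟨col, hc1, hc2, hc3⟩ := exec_colProg (G := G) (D := 4 * s) (j := L)
    (σ := fun v => { σ v with level := lev v }) hq hq' (fun v => h3 v (hlt v))
    (fun v => by
      change (σ v).col < _
      rw [h.col v]
      exact (h.ident_lt v).trans_le (Nat.le_mul_of_pos_right _ hq.pos))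
    (fun u v huv => by
      change (σ u).col = (σ v).col at huv
      rw [h.col u, h.col v] at huv
      exact h.ident_injective huv)
  refine ⟨lev, col, ?_, hlt, hc2, fun v => h3 v (hlt v), fun v => (hc3 v).trans (by omega)⟩
  rw [partitionProg, exec_append, h1, hc1]

/-- Every class is split into `p` sparser classes. -/
noncomputable def phaseProg (L p s : ℕ) : List (Step ProcState) :=
  partitionProg L s (primeAfter (4 * p + 18)) ++
    (pickProg (4 * s) p (primeAfter (4 * p + 18) ^ 2) (L * primeAfter (4 * p + 18) ^ 2) ++
      [refineStep p])

theorem Ready.exec_phaseProg {L p s K : ℕ} {σ : V → ProcState} (h : Ready G L s K σ)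
    (hL : Nat.card V < 2 ^ L) (hp : 0 < p) :
    Ready G L (8 * s / p) (K * p) (exec G (phaseProg L p s) σ) := by
  have hlt := lt_primeAfter (4 * p + 18)
  obtain ⟨lev, col, h1, h2, h3, h4, h5⟩ :=
    h.exec_partitionProg hL (prime_primeAfter (4 * p + 18)) (by omega)
  rw [phaseProg, exec_append, exec_append, h1]
  set q := primeAfter (4 * p + 18) with hq
  set H := classGraph G fun v => (σ v).cls with hH
  set rank : V → ℕ := fun v => lev v * q ^ 2 + col v with hrank
  have hrank_lev : ∀ u v, rank v ≤ rank u → lev v ≤ lev u := by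
    intro u v huv
    by_contra! hlev
    have := h3 u
    have h6 : (lev u + 1) * q ^ 2 ≤ lev v * q ^ 2 := Nat.mul_le_mul_right _ hlev
    simp only [hrank] at huv
    rw [add_mul] at h6
    omega
  have hrank_lt : ∀ v, rank v < L * q ^ 2 := by
    intro v
    have := h3 v
    have h6 : (lev v + 1) * q ^ 2 ≤ L * q ^ 2 := Nat.mul_le_mul_right _ (h2 v)
    simp only [hrank]
    rw [add_mul] at h6
    omega
  obtain ⟨pick, hp1, hp2, hp3⟩ := exec_pickProg (G := G) (D := 4 * s) (Q := q ^ 2) hp (L * q ^ 2)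
    (σ := fun v => { σ v with level := lev v, col := col v })
    (fun v => (Set.ncard_le_ncard fun u (hu : H.Adj v u ∧ rank v < rank u) =>
      (⟨hu.1, hrank_lev u v hu.2.le⟩ : H.Adj v u ∧ lev v ≤ lev u)).trans (h4 v))
    -- No rank reaches `L * q ^ 2`, so initially the invariant is vacuous.
    (fun v hv => absurd hv (not_le.2 (hrank_lt v)))
  rw [hp1, exec_cons, exec_nil]
  refine ⟨?_, fun _ => rfl, fun _ => rfl, h.ident_injective, h.ident_lt, ?_⟩
  · have hcls : ∀ u v, (σ u).cls * p + pick u = (σ v).cls * p + pick v →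
        (σ u).cls = (σ v).cls ∧ pick u = pick v := by
      intro u v huv
      have e1 := congrArg (· / p) huv
      have e2 := congrArg (· % p) huv
      simp only [mul_comm _ p, Nat.mul_add_div hp, Nat.div_eq_of_lt (hp2 _), Nat.mul_add_mod,
        Nat.mod_eq_of_lt (hp2 _), add_zero] at e1 e2
      exact ⟨e1, e2⟩
    -- Edges between equal ranks are oriented both ways. Out-neighbours of higher rank are few by
    -- the choice of parts, those of equal rank by the defect of the colouring.
    refine SimpleGraph.sparse_of_orientation (fun v u => rank v ≤ rank u)
      (fun u v _ => le_total _ _) fun v => ?_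
    rw [Nat.le_div_iff_mul_le hp]
    have hsub : {u | (classGraph G fun v => (σ v).cls * p + pick v).Adj v u ∧ rank v ≤ rank u} ⊆
        {u | H.Adj v u ∧ rank v < rank u ∧ pick u = pick v} ∪
          {u | H.Adj v u ∧ lev v ≤ lev u ∧ col u = col v} := by
      rintro u ⟨⟨hu, hc⟩, hr⟩
      obtain ⟨hc1, hc2⟩ := hcls _ _ hc
      rcases hr.lt_or_eq with hr | hr
      · exact Or.inl ⟨⟨hu, hc1⟩, hr, hc2⟩
      · have e : lev v = lev u := le_antisymm (hrank_lev _ _ hr.le) (hrank_lev _ _ hr.ge)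
        refine Or.inr ⟨⟨hu, hc1⟩, e.le, ?_⟩
        simp only [hrank, e] at hr
        omega
    have e1 := hp3 v
    -- Since `4 * p ≤ q`, the defect `16 * s / q` is at most `4 * s / p`.
    have e2 : {u | H.Adj v u ∧ lev v ≤ lev u ∧ col u = col v}.ncard * p * 4 ≤ 4 * s * 4 := by
      calc _ = {u | H.Adj v u ∧ lev v ≤ lev u ∧ col u = col v}.ncard * (4 * p) := by ring
        _ ≤ _ := Nat.mul_le_mul_left _ (by omega)
        _ ≤ 16 * s := h5 v
        _ = 4 * s * 4 := by ring
    calc _ ≤ (_ + _) * p :=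
          Nat.mul_le_mul_right _ ((Set.ncard_le_ncard hsub).trans (Set.ncard_union_le _ _))
      _ ≤ 4 * s + 4 * s := by
          rw [add_mul]
          exact Nat.add_le_add e1 (Nat.le_of_mul_le_mul_right e2 (by norm_num))
      _ = 8 * s := by ring
  · intro v
    change (σ v).cls * p + pick v < K * p
    have := hp2 v
    have h6 : ((σ v).cls + 1) * p ≤ K * p := Nat.mul_le_mul_right _ (h.cls_lt v)
    rw [add_mul] at h6
    omega

/-- The class and the colour of a processor are combined. -/
def combineStep (Q : ℕ) : Step ProcState := fun s _ => { s with cls := s.cls * Q + s.col }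

/-- The classes are coloured with few colours each. -/
noncomputable def legalProg (L s : ℕ) : List (Step ProcState) :=
  partitionProg L s (primeAfter (16 * s + 18)) ++ [combineStep (primeAfter (16 * s + 18) ^ 2)]

/-- With a modulus above `16 * s` the defect is less than 1, hence 0. On an edge inside a class,
this applies to the endpoint whose level is not higher. -/
theorem Ready.exec_legalProg {L s K : ℕ} {σ : V → ProcState} (h : Ready G L s K σ)
    (hL : Nat.card V < 2 ^ L) :
    (∀ u v, G.Adj u v → (exec G (legalProg L s) σ u).cls ≠ (exec G (legalProg L s) σ v).cls) ∧
      ∀ v, (exec G (legalProg L s) σ v).cls < K * primeAfter (16 * s + 18) ^ 2 := by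
  have hlt := lt_primeAfter (16 * s + 18)
  obtain ⟨lev, col, h1, h2, h3, h4, h5⟩ :=
    h.exec_partitionProg hL (prime_primeAfter (16 * s + 18)) (by omega)
  rw [legalProg, exec_append, h1, exec_cons, exec_nil]
  set q := primeAfter (16 * s + 18) with hq
  have hlegal : ∀ u v, G.Adj v u → (σ u).cls = (σ v).cls → lev v ≤ lev u → col u ≠ col v := by
    intro u v huv hc hl hcol
    have hpos : 0 < {u | (classGraph G fun v => (σ v).cls).Adj v u ∧ lev v ≤ lev u ∧
      col u = col v}.ncard := (Set.ncard_pos).2 ⟨u, ⟨huv, hc⟩, hl, hcol⟩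
    have := h5 v
    have := Nat.le_mul_of_pos_left q hpos
    omega
  constructor
  · intro u v huv heq
    change (σ u).cls * q ^ 2 + col u = (σ v).cls * q ^ 2 + col v at heq
    have hq2 : 0 < q ^ 2 := (Nat.zero_le _).trans_lt (h3 u)
    have e1 := congrArg (· / q ^ 2) heq
    have e2 := congrArg (· % q ^ 2) heq
    simp only [mul_comm _ (q ^ 2), Nat.mul_add_div hq2, Nat.div_eq_of_lt (h3 _), Nat.mul_add_mod,
      Nat.mod_eq_of_lt (h3 _), add_zero] at e1 e2
    rcases le_total (lev v) (lev u) with hl | hl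
    · exact hlegal u v huv.symm e1 hl e2
    · exact hlegal v u huv e1.symm hl e2.symm
  · intro v
    change (σ v).cls * q ^ 2 + col v < K * q ^ 2
    have := h3 v
    have h6 : ((σ v).cls + 1) * q ^ 2 ≤ K * q ^ 2 := Nat.mul_le_mul_right _ (h.cls_lt v)
    rw [add_mul] at h6
    omega

/-- The classes are split `r` times into `p` parts each, and then coloured. -/
noncomputable def coloringProg (L p : ℕ) : ℕ → ℕ → List (Step ProcState)
  | 0, s => legalProg L s
  | r + 1, s => phaseProg L p s ++ coloringProg L p r (8 * s / p)

theorem length_coloringProg (L p r s : ℕ) : (coloringProg L p r s).length =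
    r * (L + (L + 1) + L * primeAfter (4 * p + 18) ^ 2 + 1) + (L + (L + 1) + 1) := by
  induction r generalizing s with
  | zero => simp [coloringProg, legalProg, partitionProg, length_colProg, add_assoc]
  | succ r ih =>
    simp only [coloringProg, phaseProg, partitionProg, List.length_append, List.length_replicate,
      length_colProg, length_pickProg, List.length_singleton, ih]
    ring

theorem Ready.exec_coloringProg {L p r s K : ℕ} {σ : V → ProcState} (h : Ready G L s K σ)
    (hL : Nat.card V < 2 ^ L) (hp : 0 < p) : ∃ s', s' * p ^ r ≤ 8 ^ r * s ∧
    (∀ u v, G.Adj u v → (exec G (coloringProg L p r s) σ u).cls ≠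
      (exec G (coloringProg L p r s) σ v).cls) ∧
    ∀ v, (exec G (coloringProg L p r s) σ v).cls <
      K * p ^ r * primeAfter (16 * s' + 18) ^ 2 := by
  induction r generalizing s K σ with
  | zero => exact ⟨s, by simp, by simpa [coloringProg] using h.exec_legalProg hL⟩
  | succ r ih =>
    obtain ⟨s', h1, h2, h3⟩ := ih (h.exec_phaseProg hL hp)
    rw [coloringProg, exec_append]
    refine ⟨s', ?_, h2, fun v => (h3 v).trans_le (le_of_eq (by ring))⟩
    calc s' * p ^ (r + 1) = s' * p ^ r * p := by ring
      _ ≤ 8 ^ r * (8 * s / p) * p := Nat.mul_le_mul_right _ h1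
      _ = 8 ^ r * (8 * s / p * p) := by ring
      _ ≤ 8 ^ r * (8 * s) := Nat.mul_le_mul_left _ (Nat.div_mul_le_self _ _)
      _ = 8 ^ (r + 1) * s := by ring

theorem ready_init [Fintype V] (N : Network V) {a L : ℕ} (ha : N.graph.arboricity ≤ a)
    (hL : Fintype.card V < 2 ^ L) : Ready N.graph L a 1 fun v => ⟨N.id v, 0, 0, N.id v, 0⟩ where
  sparse := by
    have : (classGraph N.graph fun _ => 0) = N.graph := by
      ext u v
      simp
    rw [this]
    exact SimpleGraph.sparse_of_arboricity_le ha
  level _ := rfl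
  col _ := rfl
  ident_injective := N.id_injective
  ident_lt v := (N.id_mem v).2.trans_lt hL
  cls_lt _ := one_pos

/-! ### Choice of parameters, running time and number of colours -/

/-- The number of parts into which a class is split at a time. -/
noncomputable def ColoringParams.parts (r : ℕ) (P : ColoringParams) : ℕ :=
  ⌈((P.a : ℝ) / P.t) ^ (1 / (r : ℝ))⌉₊

/-- The program of the colouring algorithm. -/
noncomputable def ColoringParams.prog (r : ℕ) (P : ColoringParams) : List (Step ProcState) :=
  if P.n ≤ 1 then [] else coloringProg (Nat.log 2 P.n + 1) (P.parts r) r P.a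

/-- As the root of `x` is at least 1, rounding it up at most doubles it. -/
theorem ceil_rpow_bounds {x : ℝ} (hx : 1 ≤ x) {r : ℕ} (hr : r ≠ 0) :
    0 < ⌈x ^ (1 / (r : ℝ))⌉₊ ∧ x ≤ (⌈x ^ (1 / (r : ℝ))⌉₊ : ℝ) ^ r ∧
      (⌈x ^ (1 / (r : ℝ))⌉₊ : ℝ) ^ r ≤ 2 ^ r * x ∧
      (⌈x ^ (1 / (r : ℝ))⌉₊ : ℝ) ^ 2 ≤ 4 * x ^ (2 / (r : ℝ)) := by
  have hx0 : (0 : ℝ) ≤ x := zero_le_one.trans hx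
  set y := x ^ (1 / (r : ℝ)) with hy
  have hy1 : 1 ≤ y := Real.one_le_rpow hx (by positivity)
  have hyr : y ^ r = x := by
    rw [hy, one_div]
    exact Real.rpow_inv_natCast_pow hx0 hr
  have hy2 : y ^ 2 = x ^ (2 / (r : ℝ)) := by
    rw [hy, ← Real.rpow_natCast, ← Real.rpow_mul hx0]
    congr 1
    push_cast
    ring
  have hle : y ≤ ⌈y⌉₊ := Nat.le_ceil y
  have hge : (⌈y⌉₊ : ℝ) ≤ 2 * y := by
    have := Nat.ceil_lt_add_one (zero_le_one.trans hy1)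
    linarith
  refine ⟨Nat.ceil_pos.2 (by linarith), ?_, ?_, ?_⟩
  · rw [← hyr]
    gcongr
  · rw [← hyr, ← mul_pow]
    gcongr
  · rw [← hy2]
    calc (⌈y⌉₊ : ℝ) ^ 2 ≤ (2 * y) ^ 2 := by gcongr
      _ = 4 * y ^ 2 := by ring

theorem natLog_add_one_le_logb {n : ℕ} (hn : 2 ≤ n) :
    ((Nat.log 2 n + 1 : ℕ) : ℝ) ≤ 2 * Real.logb 2 n := by
  have h1 : ((Nat.log 2 n : ℕ) : ℝ) ≤ Real.logb 2 n := Real.natLog_le_logb n 2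
  have h2 : (1 : ℝ) ≤ Real.logb 2 n := by
    rw [Real.le_logb_iff_rpow_le (by norm_num) (by positivity), Real.rpow_one]
    exact_mod_cast hn
  push_cast
  linarith

theorem length_coloringProg_le (L p r s : ℕ) (hp : 0 < p) (hL : 0 < L) :
    (coloringProg L p r s).length ≤ 2120 * (r + 1) * (L * p ^ 2) := by
  have h1 := primeAfter_le (4 * p + 18)
  rw [length_coloringProg]
  set q := primeAfter (4 * p + 18)
  have h2 : q ^ 2 + 4 ≤ 2120 * p ^ 2 := by
    -- Here `q ≤ 8 * p + 38 ≤ 46 * p` because `1 ≤ p`.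
    calc q ^ 2 + 4 ≤ (46 * p) ^ 2 + 4 * p ^ 2 :=
          Nat.add_le_add (Nat.pow_le_pow_left (by omega) 2)
            (Nat.le_mul_of_pos_right _ (by positivity))
      _ = 2120 * p ^ 2 := by ring
  calc _ ≤ r * (L * (q ^ 2 + 4)) + L * (q ^ 2 + 4) := by
        refine Nat.add_le_add (Nat.mul_le_mul_left _ ?_) ?_ <;> rw [mul_add]
        · omega
        · have := Nat.zero_le (L * q ^ 2)
          omega
    _ = (r + 1) * (L * (q ^ 2 + 4)) := by ring
    _ ≤ (r + 1) * (L * (2120 * p ^ 2)) := by gcongr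
    _ = _ := by ring

theorem length_prog_le {μ : ℝ} {r : ℕ} (hr : r ≠ 0) (hμ : 2 / (r : ℝ) ≤ μ) {n a : ℕ} {t : ℝ}
    (ht : 1 ≤ t) (hta : t ≤ a) :
    ((ColoringParams.prog r ⟨n, a, t⟩).length : ℝ) ≤
      16960 * (r + 1) * ((a : ℝ) / t) ^ μ * Real.logb 2 n := by
  have hx : 1 ≤ (a : ℝ) / t := (one_le_div (by linarith)).2 hta
  obtain ⟨h1, -, -, h4⟩ := ceil_rpow_bounds hx hr
  -- For `n ≤ 1` the logarithm vanishes (at `n = 0` by convention), so no round is allowed and the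
  -- program is empty.
  by_cases hn : n ≤ 1
  · have : Real.logb 2 (n : ℝ) = 0 := by interval_cases n <;> simp
    simp [ColoringParams.prog, hn, this]
  · rw [ColoringParams.prog, if_neg hn]
    have hlen := length_coloringProg_le (Nat.log 2 n + 1) (ColoringParams.parts r ⟨n, a, t⟩) r a h1
      (Nat.succ_pos _)
    have hlog := natLog_add_one_le_logb (not_le.1 hn)
    have hpow : ((a : ℝ) / t) ^ (2 / (r : ℝ)) ≤ ((a : ℝ) / t) ^ μ :=
      Real.rpow_le_rpow_of_exponent_le hx hμ
    calc _ ≤ ((2120 * (r + 1) * ((Nat.log 2 n + 1) * ColoringParams.parts r ⟨n, a, t⟩ ^ 2) : ℕ) : ℝ) :=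
          by exact_mod_cast hlen
      _ = 2120 * (r + 1) * (((Nat.log 2 n + 1 : ℕ) : ℝ) *
          (ColoringParams.parts r ⟨n, a, t⟩ : ℝ) ^ 2) := by push_cast; ring
      _ ≤ 2120 * (r + 1) * ((2 * Real.logb 2 n) * (4 * ((a : ℝ) / t) ^ μ)) := by
          have : (0 : ℝ) ≤ 2 * Real.logb 2 n := (Nat.cast_nonneg _).trans hlog
          have h5 : (ColoringParams.parts r ⟨n, a, t⟩ : ℝ) ^ 2 ≤ 4 * ((a : ℝ) / t) ^ μ :=
            h4.trans (by gcongr)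
          gcongr
      _ = _ := by ring

theorem exec_prog {V : Type*} [Fintype V] (N : Network V) {r : ℕ} (hr : r ≠ 0) {a : ℕ} {t : ℝ}
    (ht : 1 ≤ t) (hta : t ≤ a) (ha : N.graph.arboricity ≤ a) {τ : V → ProcState}
    (hτ : τ = exec N.graph (ColoringParams.prog r ⟨Fintype.card V, a, t⟩)
      fun v => ⟨N.id v, 0, 0, N.id v, 0⟩) :
    (∀ u v, N.graph.Adj u v → (τ u).cls ≠ (τ v).cls) ∧
      ∀ v, (((τ v).cls + 1 : ℕ) : ℝ) ≤ 5776 * 128 ^ r * a * t := by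
  have ht0 : 0 < t := by linarith
  have hx : 1 ≤ (a : ℝ) / t := (one_le_div ht0).2 hta
  obtain ⟨h1, h2, h3, -⟩ := ceil_rpow_bounds hx hr
  have hone : (1 : ℝ) ≤ 128 ^ r := one_le_pow₀ (by norm_num)
  by_cases hn : Fintype.card V ≤ 1
  · have := Fintype.card_le_one_iff_subsingleton.1 hn
    refine ⟨fun u v huv => absurd (Subsingleton.elim u v) huv.ne, fun v => ?_⟩
    have hat : (1 : ℝ) ≤ a * t := by nlinarith
    simp only [hτ, ColoringParams.prog, hn, if_true, exec_nil, zero_add, Nat.cast_one]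
    nlinarith
  · obtain ⟨s', hs, hlegal, hcls⟩ := (ready_init N ha (Nat.lt_pow_succ_log_self one_lt_two _)
      ).exec_coloringProg (r := r) (by
        rw [Nat.card_eq_fintype_card]
        exact Nat.lt_pow_succ_log_self one_lt_two _) h1
    rw [ColoringParams.prog, if_neg hn] at hτ
    change τ = exec N.graph (coloringProg (Nat.log 2 (Fintype.card V) + 1)
      ⌈((a : ℝ) / t) ^ (1 / (r : ℝ))⌉₊ r a) _ at hτ
    rw [Nat.succ_eq_add_one, ← hτ] at hlegal hcls
    refine ⟨hlegal, fun v => ?_⟩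
    set p := ⌈((a : ℝ) / t) ^ (1 / (r : ℝ))⌉₊
    have hs' : (s' : ℝ) ≤ 8 ^ r * t := by
      have h5 : (s' : ℝ) * p ^ r ≤ 8 ^ r * a := by exact_mod_cast hs
      have h6 : (s' : ℝ) * (a / t) ≤ 8 ^ r * t * (a / t) := by
        calc (s' : ℝ) * (a / t) ≤ s' * p ^ r := by gcongr
          _ ≤ 8 ^ r * a := h5
          _ = 8 ^ r * t * (a / t) := by field_simp
      exact le_of_mul_le_mul_right h6 (by linarith)
    have h8 : (1 : ℝ) ≤ 8 ^ r := one_le_pow₀ (by norm_num)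
    have hq : (primeAfter (16 * s' + 18) : ℝ) ≤ 76 * (8 ^ r * t) := by
      have h7 : (primeAfter (16 * s' + 18) : ℝ) ≤ 2 * (16 * s' + 18) + 2 := by
        exact_mod_cast primeAfter_le (16 * s' + 18)
      have : (1 : ℝ) ≤ 8 ^ r * t := by nlinarith
      linarith
    calc (((τ v).cls + 1 : ℕ) : ℝ) ≤ ((1 * p ^ r * primeAfter (16 * s' + 18) ^ 2 : ℕ) : ℝ) :=
          Nat.cast_le.2 (hcls v)
      _ = (p : ℝ) ^ r * (primeAfter (16 * s' + 18) : ℝ) ^ 2 := by push_cast; ring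
      -- Number of classes times colours per class; `5776 = 76 ^ 2` and `128 = 2 * 8 * 8`.
      _ ≤ (2 ^ r * (a / t)) * (76 * (8 ^ r * t)) ^ 2 := by gcongr
      _ = 5776 * 128 ^ r * a * t := by
          have h128 : (128 : ℝ) ^ r = 2 ^ r * 8 ^ r * 8 ^ r := by
            rw [← mul_pow, ← mul_pow]
            norm_num
          rw [h128]
          field_simp
          norm_num

end Distributed

theorem mainTheorem8 (μ : ℝ) (hμ : 0 < μ) :
    ∃ (C : ℝ) (A : Distributed.Algorithm Distributed.ColoringParams ℕ),
      ∀ (a : ℕ) (t : ℝ), 1 ≤ t → t ≤ (a : ℝ) →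
        ∀ (V : Type*) [Fintype V] (N : Distributed.Network V), N.graph.arboricity ≤ (a : ℕ∞) →
          ∃ (r : ℕ) (φ : V → ℕ),
            (r : ℝ) ≤ C * ((a : ℝ) / t) ^ μ * Real.logb 2 (Fintype.card V : ℝ) ∧
            A.ComputesWithin ⟨Fintype.card V, a, t⟩ N r φ ∧
            (∀ u v, N.graph.Adj u v → φ u ≠ φ v) ∧
            (∀ v, 1 ≤ φ v ∧ (φ v : ℝ) ≤ C * (a : ℝ) * t) := by
  -- The number of phases; the 2 is the exponent of `p` in the running time of a phase.
  obtain ⟨k, hk⟩ := exists_nat_gt (2 / μ)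
  have hk0 : (0 : ℝ) < k := (by positivity : 0 < 2 / μ).trans hk
  have hk' : k ≠ 0 := by
    rintro rfl
    simp at hk0
  have hkμ : 2 / (k : ℝ) ≤ μ := by
    rw [div_lt_iff₀ hμ] at hk
    rw [div_le_iff₀ hk0]
    linarith
  refine ⟨5776 * 128 ^ k + 16960 * (k + 1), Distributed.programAlgorithm
    (Distributed.ColoringParams.prog k) (fun _ i => ⟨i, 0, 0, i, 0⟩) (fun s => s.cls + 1), ?_⟩
  intro a t ht hta V _ N ha
  obtain ⟨hlegal, hcls⟩ := Distributed.exec_prog N hk' ht hta ha rfl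
  refine ⟨_, _, ?_, Distributed.programAlgorithm_computesWithin N _,
    fun u v huv heq => hlegal u v huv (Nat.succ_injective heq), fun v => ⟨Nat.succ_pos _, ?_⟩⟩
  · refine (Distributed.length_prog_le hk' hkμ ht hta).trans ?_
    have hlog : 0 ≤ Real.logb 2 (Fintype.card V : ℝ) := by
      rcases Nat.eq_zero_or_pos (Fintype.card V) with h | h
      · simp [h]
      · exact Real.logb_nonneg (by norm_num) (by exact_mod_cast h)
    gcongr
    exact le_add_of_nonneg_left (by positivity)
  · refine (hcls v).trans ?_
    gcongr
    exact le_add_of_nonneg_right (by positivity)
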